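/- Let $G$ be a non-solvable generalized Baumslag–Solitar (GBS) group, i.e. $G$ is the fundamental group of a finite graph of groups with infinite cyclic vertex and edge groups. A *tree of $\mathcal D$* is a minimal metric simplicial $G$-tree (no inversions, finite quotient graph) with infinite cyclic vertex and edge stabilizers. A *cyclic factor* is a subgroup of $G$ which, for some $S\in\mathcal D$, fixes no point of $S$ and is conjugate to the fundamental group of a proper connected subgraph of the graph of groups $S/G$; $\phi\in\mathrm{Out}(G)$ is *fully irreducible* if no power $\phi^k$, $k\ge 1$, preserves the conjugacy class of a cyclic factor. Let $\phi$ be fully irreducible and let $f:T\to T$, $T\in\mathcal D$, be a train track representative of $\phi$ that multiplies lengths in every edge by the same factor $\lambda>1$. That is: $f(gx)=\Phi(g)f(x)$ for some automorphism $\Phi$ in the class $\phi$; $f$ sends vertices to vertices and maps each edge $[u,v]$ linearly, with factor $\lambda$, onto the geodesic $[f(u),f(v)]$; for the gate structure induced by $f$ (the equivalence relations on the edges with a common origin generated by $e\sim e'$ if $f(e)\cap f(e')$ has non-zero length) there are at least two gates at every vertex, and for every edge $e$ and every $k$ the path $f^k(e)$ crosses no turn formed by two edges of the same gate. A geodesic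 segment is *legal* if it crosses no turn $\{e,e'\}$ such that, for some $k\ge 0$, $f^k(e)\cap f^k(e')$ is not a single point. Then there is a constant $B$ such that $f([x,y])$ lies in the closed $B$-neighbourhood of $[f(x),f(y)]$ for all $x,y\in T$. Let $\mathrm{BBT}(f)$ be any such constant and $C_f=\frac{2\,\mathrm{BBT}(f)}{\lambda-1}$. Let $\alpha$ be a non-backtracking (i.e. geodesic) path in $T$, finite or infinite, let $\beta\subset\alpha$ be a legal compact subpath of length at least $2C_f$, and let $\beta'$ be $\beta$ with the open $\frac{C_f}{2}$-neighbourhoods of its two endpoints removed. Then for all $n\in\mathbb N$ $$f^n(\alpha\setminus\beta')\cap f^n(\beta')=\varnothing,\qquad f^n(\beta')\subset[f^n(\alpha)],\qquad \mathrm{len}([f^n(\alpha)])\ge\lambda^n\,\mathrm{len}(\beta'),$$ where $[f^n(\alpha)]$ is the non-backtracking path with the same endpoints (possibly at infinity) as $f^n(\alpha)$; explicitly, it is the set of points lying on the geodesic $[f^n(x),f^n(y)]$ for all $x,y\in\alpha$ sufficiently close to the two ends of $\alpha$. -/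

import Mathlib

open scoped Pointwise

universe u v

namespace GBS

section Trees

variable {T : Type v} [MetricSpace T]

/-- The metric segment `[x, y]`. -/
def seg (x y : T) : Set T := {z | dist x z + dist z y = dist x y}

/-- `γ` restricted to the interval `I` is a geodesic parametrized by arc length; the
non-backtracking paths of a tree are the images of such maps. -/
def IsGeodesicOn (γ : ℝ → T) (I : Set ℝ) : Prop :=
  ∀ s ∈ I, ∀ t ∈ I, dist (γ s) (γ t) = |s - t|

/-- `(u, v)` is an oriented edge for the vertex set `V`: two distinct vertices without a
vertex strictly between them. The edge itself, as a subset of the tree, is `seg u v`. -/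
def IsEdge (V : Set T) (u v : T) : Prop :=
  u ∈ V ∧ v ∈ V ∧ u ≠ v ∧ seg u v ∩ V = {u, v}

/-- `T` is (the geometric realization of) a metric simplicial tree with vertex set `V`:
a geodesic `0`-hyperbolic space (an `ℝ`-tree) which is the union of its vertices and edges, where
segments contain finitely many vertices, and a point inside an edge can be reached from
outside this edge only through one of its two endpoints. -/
structure IsSimplicialTree (V : Set T) : Prop where
  nonempty : V.Nonempty
  geodesic : ∀ x y : T, ∃ γ : ℝ → T, γ 0 = x ∧ γ (dist x y) = y ∧
    IsGeodesicOn γ (Set.Icc 0 (dist x y))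
  hyperbolic : ∀ x y z w : T,
    dist x y + dist z w ≤ max (dist x z + dist y w) (dist x w + dist y z)
  cover : ∀ x : T, x ∈ V ∨ ∃ u v, IsEdge V u v ∧ x ∈ seg u v
  finite_vertices : ∀ x y : T, (seg x y ∩ V).Finite
  edge_isolated : ∀ u v : T, IsEdge V u v → ∀ z ∈ seg u v, ∀ x, x ∉ seg u v →
    u ∈ seg x z ∨ v ∈ seg x z

/-- A subset is a (possibly non-simplicial) subtree if it is non-empty and convex. -/
def IsSubtree (Y : Set T) : Prop :=
  Y.Nonempty ∧ ∀ x ∈ Y, ∀ y ∈ Y, seg x y ⊆ Y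

/-- A subtree which is a subgraph: with every point it contains a vertex or an edge through
this point. -/
def IsSimplicialSubtree (V Y : Set T) : Prop :=
  IsSubtree Y ∧ ∀ x ∈ Y, x ∈ V ∨ ∃ u v, IsEdge V u v ∧ x ∈ seg u v ∧ seg u v ⊆ Y

/-- The tightened path `[h ∘ γ]` of the path `h ∘ γ` defined on the interval `I`, as a subset of
the tree: the points which lie on the segments `[h (γ s), h (γ t)]` for all `s`, `t`
sufficiently close to the two ends of `I`. For a compact interval it is the segment joining the two
endpoints of `h ∘ γ` (see `tighten_Icc`), for an unbounded interval it is the geodesic which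
has the same ends, possibly at infinity. -/
def tighten (h : T → T) (γ : ℝ → T) (I : Set ℝ) : Set T :=
  {z | ∃ s₀ ∈ I, ∃ t₀ ∈ I, ∀ s ∈ I, s ≤ s₀ → ∀ t ∈ I, t₀ ≤ t → z ∈ seg (h (γ s)) (h (γ t))}

theorem tighten_Icc (h : T → T) (γ : ℝ → T) {a b : ℝ} (hab : a ≤ b) :
    tighten h γ (Set.Icc a b) = seg (h (γ a)) (h (γ b)) := by
  ext z
  constructor
  · rintro ⟨s₀, hs₀, t₀, ht₀, H⟩
    exact H a ⟨le_rfl, hab⟩ hs₀.1 b ⟨hab, le_rfl⟩ ht₀.2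
  · intro hz
    refine ⟨a, ⟨le_rfl, hab⟩, b, ⟨hab, le_rfl⟩, fun s hs hsa t ht htb => ?_⟩
    rwa [le_antisymm hsa hs.1, le_antisymm ht.2 htb]

end Trees

section Groups

/-- The subgroup `H` is infinite cyclic. -/
def InfCyclic {G : Type u} [Group G] (H : Subgroup G) : Prop := IsCyclic H ∧ Infinite H

/-- The metric simplicial tree `T` with vertex set `V` is a `G`-tree (`G` acts by isometric graph
automorphisms, without inversions) with infinite cyclic vertex and edge stabilizers
and a finite quotient graph. By Bass–Serre theory this is the same as an identification of `G` with
the fundamental group of a finite (metric) graph of infinite cyclic groups. -/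
structure IsCyclicTree (G : Type u) [Group G] {T : Type v} [MetricSpace T] [MulAction G T]
    (V : Set T) : Prop where
  tree : IsSimplicialTree V
  isometric : ∀ (g : G) (x y : T), dist (g • x) (g • y) = dist x y
  smul_vertex : ∀ (g : G), ∀ x ∈ V, g • x ∈ V
  no_inversion : ∀ (g : G) (u v : T), IsEdge V u v → ¬ (g • u = v ∧ g • v = u)
  vertex_stabilizer : ∀ x ∈ V, InfCyclic (MulAction.stabilizer G x)
  edge_stabilizer : ∀ u v : T, IsEdge V u v →
    InfCyclic (MulAction.stabilizer G u ⊓ MulAction.stabilizer G v)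
  finite_vertex_orbits : ∃ F : Set T, F.Finite ∧ ∀ x ∈ V, ∃ g : G, g • x ∈ F
  finite_edge_orbits : ∃ F : Set (T × T), F.Finite ∧
    ∀ u v : T, IsEdge V u v → ∃ g : G, (g • u, g • v) ∈ F

/-- `G` is a generalized Baumslag–Solitar group. -/
def IsGBSGroup (G : Type u) [Group G] : Prop :=
  ∃ (S : Type u) (_ : MetricSpace S) (_ : MulAction G S) (V : Set S), IsCyclicTree G V

/-- The tree `T` with vertex set `V` belongs to the cyclic deformation space of `G`: its vertex
and edge stabilizers are infinite cyclic and it has no proper `G`-invariant subtree. -/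
structure InDeformationSpace (G : Type u) [Group G] {T : Type v} [MetricSpace T]
    [MulAction G T] (V : Set T) : Prop where
  cyclicTree : IsCyclicTree G V
  minimal : ∀ Y : Set T, IsSubtree Y → (∀ g : G, g • Y = Y) → Y = Set.univ

/-- `H` is a (proper, non-elliptic) cyclic factor of `G`: it is conjugate to the fundamental group
of a proper connected subgraph of the quotient graph of groups of a tree `S` of the deformation
space, and it fixes no point of `S`. In terms of `S`, such a subgroup is the setwise stabilizer
of a connected component `Y` of the preimage of the subgraph in `S`, that is, of a proper
simplicial subtree `Y` which each `g ∈ G` either preserves or makes disjoint from itself. -/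
def IsCyclicFactor {G : Type u} [Group G] (H : Subgroup G) : Prop :=
  ∃ (S : Type u) (_ : MetricSpace S) (_ : MulAction G S) (V : Set S),
    InDeformationSpace G V ∧ ∃ Y : Set S, IsSimplicialSubtree V Y ∧ Y ≠ Set.univ ∧
      (∀ g : G, g • Y = Y ∨ Disjoint (g • Y) Y) ∧
      H = MulAction.stabilizer G Y ∧
      ¬ ∃ x : S, ∀ h ∈ H, h • x = x

/-- No power `φ ^ k` (`k ≥ 1`) preserves the conjugacy class of a cyclic factor. This depends only
on the outer class of `φ`. -/
def FullyIrreducible {G : Type u} [Group G] (φ : MulAut G) : Prop :=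
  ∀ k : ℕ, 1 ≤ k → ∀ H : Subgroup G, IsCyclicFactor H →
    ¬ ∃ g : G, H.map (φ ^ k).toMonoidHom = H.map (MulAut.conj g).toMonoidHom

end Groups

section TrainTracks

variable {T : Type v} [MetricSpace T]

/-- The gate structure induced by `f`: the equivalence relation on the edges `(w, a)` with
origin `w` (here an edge is given by its terminal vertex `a`) which is generated by: `f(e) ∩ f(e')`
has non-zero length. -/
def InducedGate (V : Set T) (f : T → T) (w : T) : T → T → Prop :=
  Relation.EqvGen fun a b =>
    IsEdge V w a ∧ IsEdge V w b ∧ (f '' seg w a ∩ f '' seg w b).Nontrivial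

/-- The train track structure: `e ∼ e'` if some `f^k(e) ∩ f^k(e')` is not a single point. -/
def TrainTrackGate (f : T → T) (w a b : T) : Prop :=
  ∃ k : ℕ, (f^[k] '' seg w a ∩ f^[k] '' seg w b).Nontrivial

/-- The path obtained by applying `h` to the segment `[x, y]` crosses the turn
`{(w, a), (w, b)}`: at a parameter `z` strictly inside `[x, y]` it passes through the vertex `w`,
arriving along the edge `seg w a` and leaving along the edge `seg w b`. -/
def CrossesTurn (V : Set T) (h : T → T) (x y w a b : T) : Prop :=
  IsEdge V w a ∧ IsEdge V w b ∧ ∃ z ∈ seg x y, ∃ p ∈ seg x z, ∃ q ∈ seg z y,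
    p ≠ z ∧ q ≠ z ∧ h z = w ∧ h '' seg p z ⊆ seg w a ∧ h '' seg z q ⊆ seg w b

/-- The segment `[x, y]` is legal: it crosses only legal turns, for the train track structure. -/
def Legal (V : Set T) (f : T → T) (x y : T) : Prop :=
  ∀ w a b : T, CrossesTurn V id x y w a b → ¬ TrainTrackGate f w a b

/-- `f : T → T` is a train track representative of `φ`, linear on the edges and with the
same stretch factor `lam` on all edges. -/
structure IsTrainTrack {G : Type u} [Group G] [MulAction G T] (V : Set T) (φ : MulAut G)
    (f : T → T) (lam : ℝ) : Prop where
  equivariant : ∀ (g : G) (x : T), f (g • x) = φ g • f x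
  map_vertex : ∀ x ∈ V, f x ∈ V
  stretch_pos : 0 < lam
  stretch : ∀ u v : T, IsEdge V u v → ∀ x ∈ seg u v, ∀ y ∈ seg u v,
    dist (f x) (f y) = lam * dist x y
  two_gates : ∀ w ∈ V, ∃ a b : T, IsEdge V w a ∧ IsEdge V w b ∧ ¬ InducedGate V f w a b
  legal_images : ∀ (k : ℕ) (u v : T), IsEdge V u v → ∀ w a b : T,
    CrossesTurn V f^[k] u v w a b → ¬ InducedGate V f w a b

/-- `B` is a bounded backtracking constant `BBT(f)`: every `f([x, y])` lies in the
`B`-neighbourhood of `[f(x), f(y)]`. -/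
def IsBBT (f : T → T) (B : ℝ) : Prop :=
  ∀ x y : T, ∀ z ∈ seg x y, ∃ p ∈ seg (f x) (f y), dist (f z) p ≤ B

/-- The critical constant `2 BBT(f) / (λ - 1)`. -/
noncomputable def criticalConstant (B lam : ℝ) : ℝ := 2 * B / (lam - 1)

/-- The segment `[x, y]` with the (open) `r`-neighbourhoods of its endpoints removed. -/
def trim (x y : T) (r : ℝ) : Set T := {z ∈ seg x y | r ≤ dist x z ∧ r ≤ dist z y}

/-- The length of a non-backtracking path, given as a subset of the tree, is its diameter. -/
noncomputable def len (A : Set T) : ENNReal := Metric.ediam A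

end TrainTracks

end GBS

/-! Put r = C_f/2 = BBT(f)/(λ-1). Tightening costs a geometric series, BBT(f^(n+1)) ≤ λ BBT(f^n) +
BBT(f), so r(λ^n - 1) is a backtracking constant for f^n (`IsBBT.iterate`). On the legal path β,
however, f^n stretches by exactly λ^n (`dist_iterate_of_legal`), so a point of β' goes to distance
at least rλ^n from the images of the ends of β. This exceeds r(λ^n - 1) by r: backtracking outside β
cannot reach f^n(β'). Disjointness, containment in the tightened path and the length bound follow.
Only disjointness needs the strict inequality; if r = 0, then f is injective (`IsBBT.injective`).

A constant BBT(f) exists because f is Lipschitz with uniformly bounded fibres (`exists_fiber_bound`,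
`isBBT_of_fibers`). The bound on fibres rests on cocompactness and on infinite subgroups of cyclic
groups having finite index. -/

namespace GBS

/-! ### Segments and turns in a metric space. -/

section Segments

variable {T : Type v} [MetricSpace T]

theorem mem_seg {x y z : T} : z ∈ seg x y ↔ dist x z + dist z y = dist x y := Iff.rfl

theorem mem_seg_of_le {x y z : T} (h : dist x z + dist z y ≤ dist x y) : z ∈ seg x y :=
  le_antisymm h (dist_triangle _ _ _)

theorem left_mem_seg (x y : T) : x ∈ seg x y := by simp [mem_seg]

theorem right_mem_seg (x y : T) : y ∈ seg x y := by simp [mem_seg]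

theorem seg_comm (x y : T) : seg x y = seg y x := by
  ext z
  rw [mem_seg, mem_seg, dist_comm x z, dist_comm z y, dist_comm x y, add_comm]

theorem mem_seg_self {x z : T} (h : z ∈ seg x x) : z = x := by
  rw [mem_seg, dist_self] at h
  have := dist_comm x z
  exact dist_le_zero.1 (by linarith [dist_nonneg (x := x) (y := z)])

theorem mem_seg_trans_left {x x' y z : T} (hx : x' ∈ seg x y) (hz : z ∈ seg x' y) :
    z ∈ seg x y := by
  rw [mem_seg] at hx hz
  exact mem_seg_of_le (by linarith [dist_triangle x x' z])

theorem mem_seg_trans_right {x y y' z : T} (hy : y' ∈ seg x y) (hz : z ∈ seg x y') :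
    z ∈ seg x y := by
  rw [seg_comm] at hy hz ⊢
  exact mem_seg_trans_left hy hz

theorem mem_seg_of_mem_of_mem {x x' y z : T} (hx : x' ∈ seg x y) (hz : z ∈ seg x' y) :
    x' ∈ seg x z := by
  rw [mem_seg] at hx hz
  exact mem_seg_of_le (by linarith [dist_triangle x z y])

theorem CrossesTurn.mono_left {V : Set T} {h : T → T} {x x' y w a b : T}
    (hc : CrossesTurn V h x' y w a b) (hx : x' ∈ seg x y) : CrossesTurn V h x y w a b := by
  obtain ⟨ha, hb, z, hz, p, hp, q, hq, rest⟩ := hc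
  exact ⟨ha, hb, z, mem_seg_trans_left hx hz, p,
    mem_seg_trans_left (mem_seg_of_mem_of_mem hx hz) hp, q, hq, rest⟩

theorem CrossesTurn.mono_right {V : Set T} {h : T → T} {x y y' w a b : T}
    (hc : CrossesTurn V h x y' w a b) (hy : y' ∈ seg x y) : CrossesTurn V h x y w a b := by
  obtain ⟨ha, hb, z, hz, p, hp, q, hq, rest⟩ := hc
  refine ⟨ha, hb, z, mem_seg_trans_right hy hz, p, hp, q, ?_, rest⟩
  rw [seg_comm] at hy hz
  have := mem_seg_of_mem_of_mem hy hz
  rw [seg_comm] at this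
  exact mem_seg_trans_right this hq

theorem IsEdge.symm {V : Set T} {u v : T} (h : IsEdge V u v) : IsEdge V v u := by
  obtain ⟨hu, hv, hne, hs⟩ := h
  exact ⟨hv, hu, hne.symm, by rw [seg_comm, hs, Set.pair_comm]⟩

end Segments

/-! ### Geometry of simplicial trees. -/

namespace IsSimplicialTree

variable {T : Type v} [MetricSpace T] {V : Set T}

theorem exists_mem_seg (hV : IsSimplicialTree V) {x y : T} {d : ℝ} (h0 : 0 ≤ d)
    (hd : d ≤ dist x y) : ∃ z ∈ seg x y, dist x z = d := by
  obtain ⟨γ, hx, hy, hγ⟩ := hV.geodesic x y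
  have h1 := hγ 0 ⟨le_rfl, h0.trans hd⟩ d ⟨h0, hd⟩
  have h2 := hγ d ⟨h0, hd⟩ _ ⟨h0.trans hd, le_rfl⟩
  rw [hx, zero_sub, abs_neg, abs_of_nonneg h0] at h1
  rw [hy, abs_sub_comm, abs_of_nonneg (sub_nonneg.2 hd)] at h2
  exact ⟨γ d, by rw [mem_seg]; linarith, h1⟩

theorem eq_of_mem_seg (hV : IsSimplicialTree V) {x y z z' : T} (hz : z ∈ seg x y)
    (hz' : z' ∈ seg x y) (h : dist x z = dist x z') : z = z' := by
  rw [mem_seg] at hz hz'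
  have h4 := hV.hyperbolic x y z z'
  rw [dist_comm y z', dist_comm y z] at h4
  have : max (dist x z + dist z' y) (dist x z' + dist z y) ≤ dist x y :=
    max_le (by linarith) (by linarith)
  exact dist_le_zero.1 (by linarith)

/-- Triangles are tripods, so [x, y] is covered by [x, p] and [p, y]: the two terms of the maximum
in the four-point inequality give the two cases. -/
theorem mem_seg_or (hV : IsSimplicialTree V) {x y z : T} (hz : z ∈ seg x y) (p : T) :
    z ∈ seg x p ∨ z ∈ seg p y := by
  rw [mem_seg] at hz
  rcases le_max_iff.1 (hV.hyperbolic x y z p) with h | h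
  · right
    rw [seg_comm]
    exact mem_seg_of_le (by linarith [dist_comm z y])
  · left
    exact mem_seg_of_le (by linarith [dist_comm z y])

theorem seg_subset (hV : IsSimplicialTree V) {x y p q : T} (hp : p ∈ seg x y)
    (hq : q ∈ seg x y) : seg p q ⊆ seg x y := by
  intro z hz
  rcases hV.mem_seg_or hq p with h | h
  · have h1 : p ∈ seg q y := by
      rw [mem_seg] at *
      linarith [dist_triangle q p y, dist_triangle x q y, dist_comm p q]
    rw [seg_comm] at hz
    exact mem_seg_trans_left hq (mem_seg_trans_right h1 hz)
  · exact mem_seg_trans_left hp (mem_seg_trans_right h hz)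

/-- The median of three points. -/
theorem exists_median (hV : IsSimplicialTree V) (x y w : T) :
    ∃ m, m ∈ seg w x ∧ m ∈ seg w y ∧ m ∈ seg x y := by
  have t1 := dist_triangle w x y
  have t2 := dist_triangle w y x
  have t3 := dist_triangle_right x y w
  have c1 := dist_comm x w
  have c2 := dist_comm y w
  have c3 := dist_comm x y
  -- The Gromov product of `x` and `y` at `w`, which is the distance from `w` to the centre of the
  -- tripod.
  set g := (dist w x + dist w y - dist x y) / 2 with hg
  obtain ⟨m, hm, hmd⟩ := hV.exists_mem_seg (x := w) (y := x) (d := g) (by linarith) (by linarith)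
  have hxm : dist x m = dist w x - g := by
    rw [mem_seg] at hm
    linarith [dist_comm x m]
  have h1 : dist y m ≤ dist w y - g := by
    have := hV.hyperbolic y m w x
    rw [c2, dist_comm m x, dist_comm y x, dist_comm m w, hxm, hmd] at this
    rcases le_max_iff.1 this with h | h <;> linarith
  refine ⟨m, hm, mem_seg_of_le ?_, mem_seg_of_le ?_⟩ <;> linarith [dist_comm m y]

/-- A vertex is joined to any other point by a segment starting along an edge. -/
theorem exists_edge_towards (hV : IsSimplicialTree V) {w x : T} (hw : w ∈ V) (hx : x ≠ w) :
    ∃ a, IsEdge V w a ∧ (x ∈ seg w a ∨ a ∈ seg w x) := by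
  by_cases hne : ((seg w x ∩ V) \ {w}).Nonempty
  · have hfin : ((seg w x ∩ V) \ {w}).Finite := (hV.finite_vertices w x).sdiff
    obtain ⟨a, ⟨⟨haS, haV⟩, haw⟩, hmin⟩ := Set.exists_min_image _ (fun a => dist w a) hfin hne
    refine ⟨a, ⟨hw, haV, Ne.symm haw, ?_⟩, Or.inr haS⟩
    ext c
    constructor
    · rintro ⟨hc, hcV⟩
      by_cases hcw : c = w
      · exact Or.inl hcw
      · have := hmin c ⟨⟨mem_seg_trans_right haS hc, hcV⟩, hcw⟩
        rw [mem_seg] at hc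
        exact Or.inr (dist_le_zero.1 (by linarith))
    · rintro (rfl | rfl)
      · exact ⟨left_mem_seg _ _, hw⟩
      · exact ⟨right_mem_seg _ _, haV⟩
  · have hno : ∀ a ∈ V, a ∈ seg w x → a = w := by
      intro a ha has
      by_contra h
      exact hne ⟨a, ⟨has, ha⟩, h⟩
    rcases hV.cover x with hxV | ⟨u, v, he, hxe⟩
    · exact absurd (hno x hxV (right_mem_seg _ _)) hx
    · by_cases hws : w ∈ seg u v
      · have : w ∈ ({u, v} : Set T) := he.2.2.2 ▸ ⟨hws, hw⟩
        rcases this with rfl | rfl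
        · exact ⟨v, he, Or.inl hxe⟩
        · exact ⟨u, he.symm, Or.inl (by rwa [seg_comm])⟩
      -- If `w` were outside the edge carrying `x`, an end of this edge would be a vertex on [w, x]
      -- other than `w`.
      · rcases hV.edge_isolated u v he x hxe w hws with h | h
        · exact absurd (hno u he.1 h ▸ left_mem_seg u v) hws
        · exact absurd (hno v he.2.1 h ▸ right_mem_seg u v) hws

theorem exists_edge_of_not_mem (hV : IsSimplicialTree V) {x y : T} (hx : x ∉ V)
    (hno : ∀ a ∈ V, a ∈ seg x y → a = y) : ∃ u v, IsEdge V u v ∧ x ∈ seg u v ∧ y ∈ seg u v := by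
  rcases hV.cover x with hxV | ⟨u, v, he, hxe⟩
  · exact absurd hxV hx
  · refine ⟨u, v, he, hxe, ?_⟩
    by_contra hy
    rcases hV.edge_isolated u v he x hxe y hy with h | h <;> rw [seg_comm] at h
    · exact hy (hno u he.1 h ▸ left_mem_seg u v)
    · exact hy (hno v he.2.1 h ▸ right_mem_seg u v)

/-- Two points without a vertex strictly between them lie in a common edge. -/
theorem exists_edge_of_no_interior_vertex (hV : IsSimplicialTree V) {x y : T} (hxy : x ≠ y)
    (hno : ∀ a ∈ V, a ∈ seg x y → a = x ∨ a = y) :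
    ∃ u v, IsEdge V u v ∧ x ∈ seg u v ∧ y ∈ seg u v := by
  by_cases hx : x ∈ V
  · by_cases hy : y ∈ V
    · refine ⟨x, y, ⟨hx, hy, hxy, ?_⟩, left_mem_seg _ _, right_mem_seg _ _⟩
      ext a
      constructor
      · rintro ⟨ha, haV⟩
        exact hno a haV ha
      · rintro (rfl | rfl)
        · exact ⟨left_mem_seg _ _, hx⟩
        · exact ⟨right_mem_seg _ _, hy⟩
    · obtain ⟨u, v, he, h1, h2⟩ := hV.exists_edge_of_not_mem (y := x) hy (by
        intro a ha has
        rw [seg_comm] at has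
        exact (hno a ha has).resolve_right (fun h => hy (h ▸ ha)))
      exact ⟨u, v, he, h2, h1⟩
  · exact hV.exists_edge_of_not_mem hx
      (fun a ha has => (hno a ha has).resolve_left (fun h => hx (h ▸ ha)))

/-- Induction on the number of vertices inside a segment. -/
theorem seg_induction (hV : IsSimplicialTree V) {P : T → T → Prop} (refl : ∀ x, P x x)
    (edge : ∀ u v, IsEdge V u v → ∀ x ∈ seg u v, ∀ y ∈ seg u v, P x y)
    (step : ∀ x y, ∀ w ∈ V, w ∈ seg x y → w ≠ x → w ≠ y → P x w → P w y → P x y)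
    (x y : T) : P x y := by
  induction hN : ((seg x y ∩ V) \ {x, y}).ncard using Nat.strong_induction_on generalizing x y with
  | _ N ih =>
    subst hN
    by_cases hxy : x = y
    · exact hxy ▸ refl x
    by_cases hno : ∀ a ∈ V, a ∈ seg x y → a = x ∨ a = y
    · obtain ⟨u, v, he, hx, hy⟩ := hV.exists_edge_of_no_interior_vertex hxy hno
      exact edge u v he x hx y hy
    push Not at hno
    obtain ⟨w, hwV, hws, hwx, hwy⟩ := hno
    have hfin : ((seg x y ∩ V) \ {x, y}).Finite := (hV.finite_vertices x y).sdiff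
    have hw : w ∈ (seg x y ∩ V) \ {x, y} := ⟨⟨hws, hwV⟩, by simp [hwx, hwy]⟩
    have anti : ∀ {a b c : T}, a ∈ seg b c → c ∈ seg b a → a = c := by
      intro a b c h1 h2
      rw [mem_seg] at h1 h2
      have := dist_comm a c
      exact dist_le_zero.1 (by linarith [dist_nonneg (x := a) (y := c)])
    refine step x y w hwV hws hwx hwy (ih _ ?_ x w rfl) (ih _ ?_ w y rfl)
    · refine Set.ncard_lt_ncard ⟨?_, fun h => (h hw).2 (Or.inr rfl)⟩ hfin
      rintro a ⟨⟨has, haV⟩, ha⟩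
      refine ⟨⟨mem_seg_trans_right hws has, haV⟩, ?_⟩
      rintro (rfl | rfl)
      · exact ha (Or.inl rfl)
      · exact hwy (anti hws has)
    · refine Set.ncard_lt_ncard ⟨?_, fun h => (h hw).2 (Or.inl rfl)⟩ hfin
      rintro a ⟨⟨has, haV⟩, ha⟩
      refine ⟨⟨mem_seg_trans_left hws has, haV⟩, ?_⟩
      rintro (rfl | rfl)
      · rw [seg_comm] at has hws
        exact hwx (anti hws has)
      · exact ha (Or.inr rfl)

/-! ### Maps stretching every edge by the same factor. -/

theorem dist_map_le (hV : IsSimplicialTree V) {h : T → T} {μ : ℝ}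
    (hh : ∀ u v, IsEdge V u v → ∀ x ∈ seg u v, ∀ y ∈ seg u v, dist (h x) (h y) = μ * dist x y)
    (x y : T) : dist (h x) (h y) ≤ μ * dist x y := by
  refine hV.seg_induction (P := fun x y => dist (h x) (h y) ≤ μ * dist x y) (by simp)
    (fun u v he x hx y hy => (hh u v he x hx y hy).le) ?_ x y
  intro x y w _ hw _ _ h1 h2
  rw [mem_seg] at hw
  rw [← hw, mul_add]
  exact (dist_triangle _ (h w) _).trans (add_le_add h1 h2)

/-- If `h` does not collapse a segment metrically at its ends, then it does not inside. -/
theorem dist_map_eq_of_mem_seg {h : T → T} {μ : ℝ}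
    (hle : ∀ x y, dist (h x) (h y) ≤ μ * dist x y) {x y z : T}
    (hxy : dist (h x) (h y) = μ * dist x y) (hz : z ∈ seg x y) :
    dist (h x) (h z) = μ * dist x z ∧ h z ∈ seg (h x) (h y) := by
  rw [mem_seg] at hz
  have h1 := hle x z
  have h2 := hle z y
  have h3 := dist_triangle (h x) (h z) (h y)
  rw [← hz, mul_add] at hxy
  exact ⟨by linarith, mem_seg_of_le (by linarith)⟩

/-- A map stretching all edges by `μ` and folding no turn of a segment stretches this segment
by `μ`. -/
theorem dist_map_eq_of_turns (hV : IsSimplicialTree V) {h : T → T} {μ : ℝ} (hμ : 0 < μ)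
    (hh : ∀ u v, IsEdge V u v → ∀ x ∈ seg u v, ∀ y ∈ seg u v, dist (h x) (h y) = μ * dist x y)
    (x y : T) (hturn : ∀ w a b, CrossesTurn V id x y w a b →
      ¬ (h '' seg w a ∩ h '' seg w b).Nontrivial) :
    dist (h x) (h y) = μ * dist x y := by
  have hle := hV.dist_map_le hh
  revert hturn
  refine hV.seg_induction (P := fun x y => (∀ w a b, CrossesTurn V id x y w a b →
      ¬ (h '' seg w a ∩ h '' seg w b).Nontrivial) → dist (h x) (h y) = μ * dist x y)
    (by simp) (fun u v he x hx y hy _ => hh u v he x hx y hy) ?_ x y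
  intro x y w hwV hw hwx hwy h1 h2 hturn
  replace h1 := h1 fun w' a b hc => hturn w' a b (hc.mono_right hw)
  replace h2 := h2 fun w' a b hc => hturn w' a b (hc.mono_left hw)
  rw [dist_comm, dist_comm x] at h1
  obtain ⟨m, hmx, hmy, hm⟩ := hV.exists_median (h x) (h y) (h w)
  -- If the tripod of `h x`, `h y`, `h w` degenerates at `h w`, the lengths of the two halves add
  -- up. Otherwise both halves begin by running along [h w, m], so the turn at `w` is folded.
  by_cases hmw : m = h w
  · subst hmw
    rw [mem_seg] at hw hm
    rw [← hm, ← hw, mul_add, ← h2, dist_comm x w, ← h1, dist_comm (h x)]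
  exfalso
  have hpos : ∀ {p q : T}, p ≠ q → 0 < dist p q := fun h => dist_pos.2 h
  have initial : ∀ {x : T}, w ≠ x → ∃ a, IsEdge V w a ∧
      ∃ p ∈ seg w x, p ≠ w ∧ p ∈ seg w a := by
    intro x hx
    obtain ⟨a, he, ha⟩ := hV.exists_edge_towards hwV hx.symm
    rcases ha with ha | ha
    · exact ⟨a, he, x, right_mem_seg _ _, hx.symm, ha⟩
    · exact ⟨a, he, a, ha, he.2.2.1.symm, right_mem_seg _ _⟩
  obtain ⟨a, hea, p, hpx, hpw, hpa⟩ := initial hwx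
  obtain ⟨b, heb, q, hqy, hqw, hqb⟩ := initial hwy
  have hmpos : 0 < dist (h w) m / μ := div_pos (hpos (Ne.symm hmw)) hμ
  -- At distance δ from `w` both sides are still in their first edges, and their images are still in
  -- the common part [h w, m].
  obtain ⟨δ, hδ, hδp, hδq, hδm⟩ : ∃ δ, 0 < δ ∧ δ ≤ dist w p ∧ δ ≤ dist w q ∧
      δ ≤ dist (h w) m / μ :=
    ⟨min (dist w p) (min (dist w q) (dist (h w) m / μ)),
      lt_min (hpos hpw.symm) (lt_min (hpos hqw.symm) hmpos), min_le_left _ _,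
      (min_le_right _ _).trans (min_le_left _ _), (min_le_right _ _).trans (min_le_right _ _)⟩
  have hδm' : μ * δ ≤ dist (h w) m := by rwa [le_div_iff₀ hμ, mul_comm] at hδm
  obtain ⟨p', hp', hpd⟩ := hV.exists_mem_seg hδ.le hδp
  obtain ⟨q', hq', hqd⟩ := hV.exists_mem_seg hδ.le hδq
  obtain ⟨r, hr, hrd⟩ := hV.exists_mem_seg (mul_pos hμ hδ).le hδm'
  have eqr : ∀ {x z : T}, dist (h w) (h x) = μ * dist w x → m ∈ seg (h w) (h x) →
      z ∈ seg w x → dist w z = δ → h z = r := by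
    intro x z hx hm hz hzd
    obtain ⟨e1, e2⟩ := dist_map_eq_of_mem_seg hle hx hz
    exact hV.eq_of_mem_seg e2 (mem_seg_trans_right hm hr) (by rw [e1, hzd, hrd])
  have hp'r := eqr h1 hmx (mem_seg_trans_right hpx hp') hpd
  have hq'r := eqr h2 hmy (mem_seg_trans_right hqy hq') hqd
  have hrw : r ≠ h w := by
    rintro rfl
    rw [dist_self] at hrd
    exact (mul_pos hμ hδ).ne hrd
  refine hturn w a b ⟨hea, heb, w, hw, p, by rwa [seg_comm], q, hqy, hpw, hqw, rfl, ?_, ?_⟩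
    ⟨r, ⟨⟨p', mem_seg_trans_right hpa hp', hp'r⟩, ⟨q', mem_seg_trans_right hqb hq', hq'r⟩⟩,
      h w, ⟨⟨w, left_mem_seg _ _, rfl⟩, ⟨w, left_mem_seg _ _, rfl⟩⟩, hrw⟩
  · rw [Set.image_id, seg_comm]
    exact fun z hz => mem_seg_trans_right hpa hz
  · rw [Set.image_id]
    exact fun z hz => mem_seg_trans_right hqb hz

/-! ### Connectedness and bounded backtracking. -/

/-- Separation: a connected set containing `x` and `y` contains `seg x y`. -/
theorem seg_subset_of_isPreconnected (hV : IsSimplicialTree V) {S : Set T}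
    (hS : IsPreconnected S) {x y : T} (hx : x ∈ S) (hy : y ∈ S) : seg x y ⊆ S := by
  intro p hp
  by_contra hpS
  -- A move shorter than the distance to `p` stays on the same side of `p`; hence both sides of `p`
  -- are open.
  have key : ∀ {q q' : T}, p ∈ seg q x → dist q q' < dist q p → p ∈ seg q' x := by
    intro q q' h hd
    rcases hV.mem_seg_or h q' with h' | h'
    · rw [mem_seg] at h'
      linarith [dist_nonneg (x := p) (y := q')]
    · exact h'
  have hA : IsOpen {q | q ≠ p ∧ p ∉ seg q x} := by
    rw [Metric.isOpen_iff]
    rintro q ⟨hqp, hq⟩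
    have hpos := dist_pos.2 hqp
    -- Here `key` is applied backwards, from `q'` to `q`; half the radius keeps `q'` farther from
    -- `p` than from `q`.
    refine ⟨dist q p / 2, by linarith, fun q' hq' => ?_⟩
    rw [Metric.mem_ball] at hq'
    have hlt : dist q' q < dist q' p := by
      linarith [dist_triangle q q' p, dist_comm q q']
    refine ⟨?_, fun h => hq (key h hlt)⟩
    rintro rfl
    linarith [dist_self q', dist_nonneg (x := q') (y := q)]
  have hB : IsOpen {q | q ≠ p ∧ p ∈ seg q x} := by
    rw [Metric.isOpen_iff]
    rintro q ⟨hqp, hq⟩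
    refine ⟨dist q p, dist_pos.2 hqp, fun q' hq' => ?_⟩
    rw [Metric.mem_ball, dist_comm] at hq'
    refine ⟨?_, key hq hq'⟩
    rintro rfl
    exact lt_irrefl _ hq'
  have hne : ∀ q ∈ S, q ≠ p := fun q hq h => hpS (h ▸ hq)
  obtain ⟨q, -, h1, h2⟩ := hS _ _ hA hB
    (fun q hq => by
      by_cases h : p ∈ seg q x
      · exact Or.inr ⟨hne q hq, h⟩
      · exact Or.inl ⟨hne q hq, h⟩)
    ⟨x, hx, hne x hx, fun h => hne x hx (mem_seg_self h).symm⟩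
    ⟨y, hy, hne y hy, by rwa [seg_comm]⟩
  exact h1.2 h2.2

theorem isPreconnected_seg (hV : IsSimplicialTree V) (x y : T) : IsPreconnected (seg x y) := by
  obtain ⟨γ, hx, hy, hγ⟩ := hV.geodesic x y
  have : seg x y = γ '' Set.Icc 0 (dist x y) := by
    have hmem : ∀ t ∈ Set.Icc 0 (dist x y), γ t ∈ seg x y ∧ dist x (γ t) = t := by
      rintro t ⟨h0, hd⟩
      have h1 := hγ 0 ⟨le_rfl, h0.trans hd⟩ t ⟨h0, hd⟩
      have h2 := hγ t ⟨h0, hd⟩ _ ⟨h0.trans hd, le_rfl⟩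
      rw [hx, zero_sub, abs_neg, abs_of_nonneg h0] at h1
      rw [hy, abs_sub_comm, abs_of_nonneg (sub_nonneg.2 hd)] at h2
      exact ⟨by rw [mem_seg]; linarith, h1⟩
    ext z
    constructor
    · intro hz
      have ht : dist x z ∈ Set.Icc 0 (dist x y) := by
        refine ⟨dist_nonneg, ?_⟩
        rw [mem_seg] at hz
        linarith [dist_nonneg (x := z) (y := y)]
      obtain ⟨h1, h2⟩ := hmem _ ht
      exact ⟨_, ht, hV.eq_of_mem_seg h1 hz h2⟩
    · rintro ⟨t, ht, rfl⟩
      exact (hmem t ht).1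
  rw [this]
  refine isPreconnected_Icc.image _ ?_
  refine LipschitzOnWith.continuousOn (K := 1) (LipschitzOnWith.of_dist_le_mul ?_)
  intro s hs t ht
  rw [hγ s hs t ht, Real.dist_eq, NNReal.coe_one, one_mul]

/-- A Lipschitz map with uniformly bounded fibres has bounded backtracking. -/
theorem isBBT_of_fibers (hV : IsSimplicialTree V) {f : T → T} {lam K : ℝ}
    (hlam : 0 ≤ lam) (hle : ∀ x y, dist (f x) (f y) ≤ lam * dist x y)
    (hK : ∀ x y, f x = f y → dist x y ≤ K) : IsBBT f (lam * K) := by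
  have hcont : Continuous f :=
    (LipschitzWith.of_dist_le_mul (K := ⟨lam, hlam⟩) hle).continuous
  have hits : ∀ x y, seg (f x) (f y) ⊆ f '' seg x y := fun x y =>
    hV.seg_subset_of_isPreconnected ((hV.isPreconnected_seg x y).image _ hcont.continuousOn)
      ⟨x, left_mem_seg _ _, rfl⟩ ⟨y, right_mem_seg _ _, rfl⟩
  intro x y z hz
  obtain ⟨p, hpx, hpy, hp⟩ := hV.exists_median (f x) (f y) (f z)
  -- The images of [z, x] and [z, y] are connected, so both pass through the centre `p` of the
  -- tripod. This gives two points of one fibre with `z` between them.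
  obtain ⟨x', hx', hfx⟩ := hits z x hpx
  obtain ⟨y', hy', hfy⟩ := hits z y hpy
  have hz' : dist x' y' = dist x' z + dist z y' := by
    rw [mem_seg] at *
    linarith [dist_triangle x' z y', dist_triangle x x' y, dist_triangle x' y' y,
      dist_comm x x', dist_comm z x', dist_comm z x]
  have hxy := hK x' y' (hfx.trans hfy.symm)
  refine ⟨p, hp, ?_⟩
  rw [← hfx, dist_comm]
  refine (hle _ _).trans (mul_le_mul_of_nonneg_left ?_ hlam)
  linarith [dist_nonneg (x := z) (y := y')]

end IsSimplicialTree

end GBS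

namespace GBS

/-! ### Local finiteness of the tree and bounded fibres. -/

section Finiteness

/-- The subgroup contains some g^m with m ≠ 0, so the remainders modulo m index enough cosets. This
is the only way in which cyclicity of stabilizers enters. -/
theorem exists_finite_transversal {G : Type*} [Group G] {H K : Subgroup G} (hH : IsCyclic H)
    (hK : Infinite K) (hKH : K ≤ H) : ∃ S : Set G, S.Finite ∧ ∀ h ∈ H, ∃ s ∈ S, s⁻¹ * h ∈ K := by
  obtain ⟨⟨g, hg⟩, hgen⟩ := hH.exists_generator
  have gen : ∀ h ∈ H, ∃ j : ℤ, g ^ j = h := by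
    intro h hh
    obtain ⟨j, hj⟩ := Subgroup.mem_zpowers_iff.1 (hgen ⟨h, hh⟩)
    exact ⟨j, by simpa using congrArg Subtype.val hj⟩
  obtain ⟨⟨k, hk⟩, hk1⟩ := exists_ne (1 : K)
  obtain ⟨m, hm⟩ := gen k (hKH hk)
  have hm0 : m ≠ 0 := by
    rintro rfl
    exact hk1 (Subtype.ext (by simpa using hm.symm))
  refine ⟨(fun i : ℤ => g ^ i) '' Set.Ico 0 |m|, (Set.finite_Ico _ _).image _, fun h hh => ?_⟩
  obtain ⟨j, rfl⟩ := gen h hh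
  refine ⟨_, ⟨j % m, ⟨Int.emod_nonneg _ hm0, Int.emod_lt_abs _ hm0⟩, rfl⟩, ?_⟩
  have : (g ^ (j % m))⁻¹ * g ^ j = k ^ (j / m) := by
    rw [← hm, ← zpow_mul, ← zpow_neg, ← zpow_add]
    congr 1
    linarith [Int.emod_add_mul_ediv j m]
  rw [this]
  exact K.zpow_mem hk _

variable {G : Type u} [Group G] {T : Type v} [MetricSpace T] [MulAction G T] {V : Set T}

namespace IsCyclicTree

theorem exists_edge_length_bounds (hT : IsCyclicTree G V) :
    ∃ ε > 0, ∃ M : ℝ, 0 ≤ M ∧ ∀ u v, IsEdge V u v → ε ≤ dist u v ∧ dist u v ≤ M := by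
  obtain ⟨F, hF, hedge⟩ := hT.finite_edge_orbits
  have hF' : ((fun e : T × T => dist e.1 e.2) '' F).Finite := hF.image _
  obtain ⟨M, hM⟩ := hF'.bddAbove
  -- `F` may contain pairs that are not edges, so zero lengths are discarded before the minimum is
  -- taken.
  have hF'' : (((fun e : T × T => dist e.1 e.2) '' F) \ {0}).Finite := hF'.sdiff
  have hε : ∃ ε > 0, ∀ r ∈ ((fun e : T × T => dist e.1 e.2) '' F) \ {0}, ε ≤ r := by
    by_cases hne : (((fun e : T × T => dist e.1 e.2) '' F) \ {0}).Nonempty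
    · obtain ⟨r, hr, hmin⟩ := Set.exists_min_image _ id hF'' hne
      refine ⟨r, lt_of_le_of_ne ?_ (Ne.symm hr.2), hmin⟩
      obtain ⟨⟨e, -, rfl⟩, -⟩ := hr
      exact dist_nonneg
    · exact ⟨1, one_pos, fun r hr => absurd ⟨r, hr⟩ hne⟩
  obtain ⟨ε, hε0, hε⟩ := hε
  refine ⟨ε, hε0, max M 0, le_max_right _ _, fun u v he => ?_⟩
  obtain ⟨g, hg⟩ := hedge u v he
  have hmem : dist u v ∈ (fun e : T × T => dist e.1 e.2) '' F :=
    ⟨_, hg, hT.isometric g u v⟩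
  exact ⟨hε _ ⟨hmem, dist_ne_zero.2 he.2.2.1⟩, (hM hmem).trans (le_max_left _ _)⟩

/-- Edges at `w` carried to the same representative differ by elements of the stabilizer of `w`, in
which an edge stabilizer has finite index. -/
theorem finite_edges_at (hT : IsCyclicTree G V) (w : T) : {a | IsEdge V w a}.Finite := by
  obtain ⟨F, hF, hedge⟩ := hT.finite_edge_orbits
  have hsub : {a | IsEdge V w a} ⊆
      ⋃ e ∈ F, {a | IsEdge V w a ∧ ∃ g : G, g • w = e.1 ∧ g • a = e.2} := by
    intro a ha
    obtain ⟨g, hg⟩ := hedge w a ha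
    exact Set.mem_biUnion hg ⟨ha, g, rfl, rfl⟩
  refine (hF.biUnion fun e _ => ?_).subset hsub
  rcases Set.eq_empty_or_nonempty {a | IsEdge V w a ∧ ∃ g : G, g • w = e.1 ∧ g • a = e.2}
    with h | ⟨a₀, ha₀, g₀, hw₀, hg₀⟩
  · rw [h]
    exact Set.finite_empty
  obtain ⟨S, hS, hSK⟩ := exists_finite_transversal (hT.vertex_stabilizer w ha₀.1).1
    (hT.edge_stabilizer w a₀ ha₀).2 inf_le_left
  refine (hS.image (fun s => s • a₀)).subset ?_
  rintro a ⟨-, g, hw, hg⟩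
  have hmem : g⁻¹ * g₀ ∈ MulAction.stabilizer G w := by
    rw [MulAction.mem_stabilizer_iff, mul_smul, hw₀, ← hw, inv_smul_smul]
  obtain ⟨s, hs, hk⟩ := hSK _ hmem
  refine ⟨s, hs, ?_⟩
  have h2 : (s⁻¹ * (g⁻¹ * g₀)) • a₀ = a₀ := (Subgroup.mem_inf.1 hk).2
  rw [mul_smul, mul_smul, hg₀, ← hg, inv_smul_smul, inv_smul_eq_iff] at h2
  exact h2.symm

/-- Balls contain finitely many vertices. -/
theorem finite_vertices_dist_le (hT : IsCyclicTree G V) (R : ℝ) {v : T} (hv : v ∈ V) :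
    {w ∈ V | dist v w ≤ R}.Finite := by
  obtain ⟨ε, hε, M, -, hM⟩ := hT.exists_edge_length_bounds
  -- Each edge on the way from `v` uses up at least ε of the radius, so n bounds the number of
  -- steps.
  obtain ⟨n, hn⟩ := exists_nat_ge (R / ε)
  rw [div_le_iff₀ hε] at hn
  induction n generalizing R v with
  | zero =>
    refine (Set.finite_singleton v).subset ?_
    rintro w ⟨-, hw⟩
    rw [Nat.cast_zero, zero_mul] at hn
    exact (dist_le_zero.1 (hw.trans hn)).symm
  | succ n ih =>
    have hsub : {w ∈ V | dist v w ≤ R} ⊆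
        {v} ∪ ⋃ a ∈ {a | IsEdge V v a}, {w ∈ V | dist a w ≤ R - ε} := by
      rintro w ⟨hwV, hw⟩
      by_cases hwv : w = v
      · exact Or.inl hwv
      right
      obtain ⟨a, hea, ha⟩ := hT.tree.exists_edge_towards hv hwv
      have ha' : a ∈ seg v w := by
        rcases ha with ha | ha
        · have : w ∈ ({v, a} : Set T) := hea.2.2.2 ▸ ⟨ha, hwV⟩
          rcases this with h | rfl
          · exact absurd h hwv
          · exact right_mem_seg _ _
        · exact ha
      refine Set.mem_biUnion (x := a) hea ⟨hwV, ?_⟩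
      rw [mem_seg] at ha'
      linarith [(hM v a hea).1]
    refine Set.Finite.subset ((Set.finite_singleton v).union
      ((hT.finite_edges_at v).biUnion fun a ha => ih (R - ε) ha.2.1 ?_)) hsub
    push_cast at hn
    linarith

/-- A map equivariant up to an automorphism has finite fibres on the vertices. -/
theorem finite_vertex_fiber (hT : IsCyclicTree G V) {φ : MulAut G} {f : T → T}
    (hf : ∀ (g : G) (x : T), f (g • x) = φ g • f x) {p : T} (hp : p ∈ V) :
    {v ∈ V | f v = p}.Finite := by
  obtain ⟨F, hF, horb⟩ := hT.finite_vertex_orbits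
  have hsub : {v ∈ V | f v = p} ⊆ ⋃ w ∈ F, {v ∈ V | f v = p ∧ ∃ g : G, g • v = w} := by
    rintro v ⟨hv, hfv⟩
    obtain ⟨g, hg⟩ := horb v hv
    exact Set.mem_biUnion hg ⟨hv, hfv, g, rfl⟩
  refine (hF.biUnion fun w _ => ?_).subset hsub
  rcases Set.eq_empty_or_nonempty {v ∈ V | f v = p ∧ ∃ g : G, g • v = w}
    with h | ⟨v₀, hv₀, hfv₀, g₀, hg₀⟩
  · rw [h]
    exact Set.finite_empty
  have hinf : Infinite ((MulAction.stabilizer G v₀).map φ.toMonoidHom) := by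
    have := (hT.vertex_stabilizer v₀ hv₀).2
    exact ((MulAction.stabilizer G v₀).equivMapOfInjective φ.toMonoidHom
      φ.injective).toEquiv.infinite_iff.1 this
  -- The image of the stabilizer of `v₀` has finite index in that of `p`. Points of the fibre in the
  -- orbit of `v₀` come from elements that φ sends into the stabilizer of `p`, so finitely many
  -- cosets account for them.
  have hle : (MulAction.stabilizer G v₀).map φ.toMonoidHom ≤ MulAction.stabilizer G p := by
    rintro _ ⟨k, hk, rfl⟩
    have hk' : k • v₀ = v₀ := hk
    change φ k • p = p
    rw [← hfv₀, ← hf, hk']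
  obtain ⟨S, hS, hSK⟩ := exists_finite_transversal (hT.vertex_stabilizer p hp).1 hinf hle
  refine (hS.image (fun s => φ.symm s • v₀)).subset ?_
  rintro v ⟨-, hfv, g, hg⟩
  have hv : v = (g⁻¹ * g₀) • v₀ := by rw [mul_smul, hg₀, ← hg, inv_smul_smul]
  have hmem : φ (g⁻¹ * g₀) ∈ MulAction.stabilizer G p := by
    have := hf (g⁻¹ * g₀) v₀
    rw [← hv, hfv, hfv₀] at this
    exact this.symm
  obtain ⟨s, hs, k, hk, hk'⟩ := hSK _ hmem
  refine ⟨s, hs, ?_⟩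
  have h1 : g⁻¹ * g₀ = φ.symm s * k := by
    apply φ.injective
    have h2 : φ k = s⁻¹ * φ (g⁻¹ * g₀) := hk'
    rw [map_mul φ _ k, h2, MulEquiv.apply_symm_apply, mul_inv_cancel_left]
  have hk'' : k • v₀ = v₀ := hk
  change φ.symm s • v₀ = v
  rw [hv, h1, mul_smul, hk'']

/-- Replacing two points of a fibre by nearby vertices `u`, `v` costs at most M each and leaves `f
u`, `f v` within 2λM. After translating `u` into a finite set, finiteness of balls and of vertex
fibres leaves finitely many possible distances. -/
theorem exists_fiber_bound (hT : IsCyclicTree G V) {φ : MulAut G} {f : T → T} {lam : ℝ}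
    (hlam : 0 ≤ lam) (hf : ∀ (g : G) (x : T), f (g • x) = φ g • f x)
    (hfV : ∀ x ∈ V, f x ∈ V) (hle : ∀ x y, dist (f x) (f y) ≤ lam * dist x y) :
    ∃ K : ℝ, ∀ x y, f x = f y → dist x y ≤ K := by
  obtain ⟨ε, -, M, hM0, hM⟩ := hT.exists_edge_length_bounds
  have near : ∀ x : T, ∃ u ∈ V, dist x u ≤ M := by
    intro x
    rcases hT.tree.cover x with hx | ⟨u, v, he, hx⟩
    · exact ⟨x, hx, by rwa [dist_self]⟩
    · refine ⟨u, he.1, ?_⟩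
      rw [mem_seg] at hx
      linarith [(hM u v he).2, dist_comm x u, dist_nonneg (x := x) (y := v)]
  obtain ⟨F, hF, horb⟩ := hT.finite_vertex_orbits
  have hfin : (⋃ u ∈ F ∩ V, (fun v => dist u v) ''
      ⋃ p ∈ {p ∈ V | dist (f u) p ≤ lam * M + lam * M}, {v ∈ V | f v = p}).Finite :=
    (hF.inter_of_left V).biUnion fun u hu => Set.Finite.image _
      ((hT.finite_vertices_dist_le _ (hfV u hu.2)).biUnion fun p hp =>
        hT.finite_vertex_fiber hf hp.1)
  obtain ⟨K, hK⟩ := hfin.bddAbove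
  refine ⟨M + K + M, fun x y hxy => ?_⟩
  obtain ⟨u, hu, hxu⟩ := near x
  obtain ⟨v, hv, hyv⟩ := near y
  have huv : dist u v ≤ K := by
    obtain ⟨g, hg⟩ := horb u hu
    rw [← hT.isometric g u v]
    have hgv := hT.smul_vertex g v hv
    refine hK (Set.mem_biUnion (x := g • u) ⟨hg, hT.smul_vertex g u hu⟩
      ⟨g • v, Set.mem_biUnion (x := f (g • v)) ⟨hfV _ hgv, ?_⟩ ⟨hgv, rfl⟩, rfl⟩)
    rw [hf, hf, hT.isometric]
    have h1 := (hle x u).trans (mul_le_mul_of_nonneg_left hxu hlam)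
    have h2 := (hle y v).trans (mul_le_mul_of_nonneg_left hyv hlam)
    have h3 := dist_triangle_left (f u) (f v) (f x)
    rw [← hxy] at h2
    linarith
  linarith [dist_triangle4 x u v y, dist_comm y v]

end IsCyclicTree

end Finiteness

/-! ### Iterates: backtracking constants and stretching of legal paths. -/

section Iterates

variable {T : Type v} [MetricSpace T] {V : Set T} {f : T → T} {lam : ℝ}

theorem IsBBT.nonneg [Nonempty T] {B : ℝ} (hB : IsBBT f B) : 0 ≤ B := by
  obtain ⟨x⟩ := ‹Nonempty T›
  obtain ⟨p, -, hp⟩ := hB x x x (left_mem_seg _ _)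
  exact dist_nonneg.trans hp

/-- Writing the constant as r(λ - 1) makes the recursion c ↦ λc + r(λ - 1) telescope to r(λ^n - 1).
-/
theorem IsBBT.iterate {r : ℝ} (hlam : 0 ≤ lam)
    (hle : ∀ x y, dist (f x) (f y) ≤ lam * dist x y) (hB : IsBBT f (r * (lam - 1))) (n : ℕ) :
    IsBBT f^[n] (r * (lam ^ n - 1)) := by
  induction n with
  | zero => exact fun x y z hz => ⟨z, hz, by simp⟩
  | succ n ih =>
    intro x y z hz
    obtain ⟨p, hp, hzp⟩ := ih x y z hz
    obtain ⟨q, hq, hpq⟩ := hB _ _ p hp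
    rw [Function.iterate_succ_apply', Function.iterate_succ_apply', Function.iterate_succ_apply']
    refine ⟨q, hq, ?_⟩
    have h1 := (hle (f^[n] z) p).trans (mul_le_mul_of_nonneg_left hzp hlam)
    have h2 := dist_triangle (f (f^[n] z)) (f p) q
    have h3 : r * (lam ^ (n + 1) - 1) = lam * (r * (lam ^ n - 1)) + r * (lam - 1) := by ring
    linarith

/-- With no backtracking, a segment whose ends have equal images is collapsed to a point, yet `f` is
injective on edges. -/
theorem IsBBT.injective (hV : IsSimplicialTree V) (hlam : 0 < lam)
    (hf : ∀ u v, IsEdge V u v → ∀ x ∈ seg u v, ∀ y ∈ seg u v,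
      dist (f x) (f y) = lam * dist x y) (hB : IsBBT f 0) : Function.Injective f := by
  intro x y hxy
  have const : ∀ z ∈ seg x y, f z = f x := by
    intro z hz
    obtain ⟨p, hp, hzp⟩ := hB x y z hz
    rw [← hxy] at hp
    rw [← mem_seg_self hp]
    exact dist_le_zero.1 hzp
  have inj : ∀ u v, IsEdge V u v → ∀ p ∈ seg u v, ∀ q ∈ seg u v, f p = f q → p = q := by
    intro u v he p hp q hq hpq
    have := hf u v he p hp q hq
    rw [hpq, dist_self] at this
    exact dist_eq_zero.1 ((mul_eq_zero.1 this.symm).resolve_left hlam.ne')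
  by_contra hne
  by_cases hx : x ∈ V
  · obtain ⟨a, he, ha | ha⟩ := hV.exists_edge_towards hx (Ne.symm hne)
    · exact hne (inj x a he _ (left_mem_seg _ _) _ ha hxy)
    · exact he.2.2.1 (inj x a he _ (left_mem_seg _ _) _ (right_mem_seg _ _) (const a ha).symm)
  · rcases hV.cover x with h | ⟨u, v, he, hxe⟩
    · exact hx h
    by_cases hys : y ∈ seg u v
    · exact hne (inj u v he _ hxe _ hys hxy)
    · rcases hV.edge_isolated u v he x hxe y hys with h | h <;> rw [seg_comm] at h
      · exact hx (inj u v he _ hxe _ (left_mem_seg _ _) (const u h).symm ▸ he.1)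
      · exact hx (inj u v he _ hxe _ (right_mem_seg _ _) (const v h).symm ▸ he.2.1)

variable {G : Type u} [Group G] [MulAction G T] {φ : MulAut G}

namespace IsTrainTrack

theorem dist_map_le (hf : IsTrainTrack V φ f lam) (hV : IsSimplicialTree V) (x y : T) :
    dist (f x) (f y) ≤ lam * dist x y :=
  hV.dist_map_le hf.stretch x y

/-- By induction f^n maps the edge onto a geodesic. Its turns are turns crossed by f^n(e), so they
lie in distinct gates and `f` does not fold them. -/
theorem dist_iterate_edge (hf : IsTrainTrack V φ f lam) (hV : IsSimplicialTree V) (n : ℕ) :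
    ∀ u v, IsEdge V u v → ∀ x ∈ seg u v, ∀ y ∈ seg u v,
      dist (f^[n] x) (f^[n] y) = lam ^ n * dist x y := by
  induction n with
  | zero => simp
  | succ n ih =>
    have hpow : 0 < lam ^ n := pow_pos hf.stretch_pos n
    have hle := hV.dist_map_le ih
    intro u v he
    have huv := ih u v he u (left_mem_seg _ _) v (right_mem_seg _ _)
    have hsurj : ∀ x ∈ seg u v, ∀ y ∈ seg u v, ∀ z ∈ seg (f^[n] x) (f^[n] y),
        ∃ z' ∈ seg x y, f^[n] z' = z := by
      intro x hx y hy z hz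
      have hxy := ih u v he x hx y hy
      have hd : dist (f^[n] x) z / lam ^ n ≤ dist x y := by
        rw [div_le_iff₀ hpow, mul_comm, ← hxy]
        rw [mem_seg] at hz
        linarith [dist_nonneg (x := z) (y := f^[n] y)]
      obtain ⟨z', hz', hzd⟩ := hV.exists_mem_seg (div_nonneg dist_nonneg hpow.le) hd
      obtain ⟨h1, h2⟩ := IsSimplicialTree.dist_map_eq_of_mem_seg hle hxy hz'
      refine ⟨z', hz', hV.eq_of_mem_seg h2 hz ?_⟩
      rw [h1, hzd, mul_div_cancel₀ _ hpow.ne']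
    -- `legal_images` speaks of whole edges, so the ends come first; the Lipschitz bound then forces
    -- equality on subsegments.
    have hend : dist (f^[n + 1] u) (f^[n + 1] v) = lam ^ (n + 1) * dist u v := by
      rw [Function.iterate_succ_apply', Function.iterate_succ_apply', pow_succ', mul_assoc, ← huv]
      refine hV.dist_map_eq_of_turns hf.stretch_pos hf.stretch _ _ ?_
      rintro w a b ⟨ha, hb, z, hz, p, hp, q, hq, hpz, hqz, hzw, hpa, hqb⟩ hnt
      refine hf.legal_images n u v he w a b ?_ (Relation.EqvGen.rel _ _ ⟨ha, hb, hnt⟩)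
      obtain ⟨z', hz', rfl⟩ := hsurj u (left_mem_seg _ _) v (right_mem_seg _ _) z hz
      obtain ⟨p', hp', rfl⟩ := hsurj u (left_mem_seg _ _) z' hz' p hp
      obtain ⟨q', hq', rfl⟩ := hsurj z' hz' v (right_mem_seg _ _) q hq
      have himg : ∀ x ∈ seg u v, ∀ y ∈ seg u v,
          f^[n] '' seg x y ⊆ seg (f^[n] x) (f^[n] y) := by
        rintro x hx y hy _ ⟨t, ht, rfl⟩
        exact (IsSimplicialTree.dist_map_eq_of_mem_seg hle (ih u v he x hx y hy) ht).2
      have hp'' := mem_seg_trans_right hz' hp'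
      have hq'' := mem_seg_trans_left hz' hq'
      rw [Set.image_id] at hpa hqb
      exact ⟨ha, hb, z', hz', p', hp', q', hq', fun h => hpz (by rw [h]),
        fun h => hqz (by rw [h]), hzw, (himg _ hp'' _ hz').trans hpa,
        (himg _ hz' _ hq'').trans hqb⟩
    have hle' : ∀ x y, dist (f^[n + 1] x) (f^[n + 1] y) ≤ lam ^ (n + 1) * dist x y := by
      intro x y
      rw [Function.iterate_succ_apply', Function.iterate_succ_apply', pow_succ', mul_assoc]
      exact (hf.dist_map_le hV _ _).trans
        (mul_le_mul_of_nonneg_left (hle x y) hf.stretch_pos.le)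
    intro x hx y hy
    have hux := (IsSimplicialTree.dist_map_eq_of_mem_seg hle' hend hx)
    rcases hV.mem_seg_or hy x with h | h
    · rw [dist_comm, dist_comm x]
      have hxu : dist (f^[n + 1] x) (f^[n + 1] u) = lam ^ (n + 1) * dist x u := by
        rw [dist_comm, dist_comm x, hux.1]
      rw [seg_comm] at h
      rw [dist_comm, dist_comm y]
      exact (IsSimplicialTree.dist_map_eq_of_mem_seg hle' hxu h).1
    · have hxv : dist (f^[n + 1] x) (f^[n + 1] v) = lam ^ (n + 1) * dist x v := by
        have h2 := hux.2
        have h1 := hux.1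
        rw [mem_seg] at h2 hx
        rw [hend, h1, ← hx, mul_add] at h2
        linarith
      exact (IsSimplicialTree.dist_map_eq_of_mem_seg hle' hxv h).1

theorem dist_iterate_of_legal (hf : IsTrainTrack V φ f lam) (hV : IsSimplicialTree V) {x y : T}
    (hleg : Legal V f x y) (n : ℕ) : dist (f^[n] x) (f^[n] y) = lam ^ n * dist x y :=
  hV.dist_map_eq_of_turns (pow_pos hf.stretch_pos n) (hf.dist_iterate_edge hV n) x y
    fun w a b hc hnt => hleg w a b hc ⟨n, hnt⟩

theorem exists_isBBT (hf : IsTrainTrack V φ f lam) (hT : IsCyclicTree G V) :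
    ∃ B, IsBBT f B := by
  have hle := hf.dist_map_le hT.tree
  obtain ⟨K, hK⟩ := hT.exists_fiber_bound hf.stretch_pos.le hf.equivariant hf.map_vertex hle
  exact ⟨_, hT.tree.isBBT_of_fibers hf.stretch_pos.le hle hK⟩

end IsTrainTrack

end Iterates

end GBS

namespace GBS

/-! ### Images of a trimmed legal subpath. -/

section LegalSubpaths

variable {T : Type v} [MetricSpace T] {V : Set T}

/-- If `p` and `q` lie on `seg x z` and a point `y` of `seg b c` is not closer to `b` than `p` and
not closer to `c` than `q`, then `y` lies on `seg x z`. -/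
theorem IsSimplicialTree.mem_seg_of_near (hV : IsSimplicialTree V) {b c p q x y z : T}
    (hy : y ∈ seg b c) (hp : p ∈ seg x z) (hq : q ∈ seg x z) (hbp : dist b p ≤ dist b y)
    (hcq : dist c q ≤ dist c y) : y ∈ seg x z := by
  rcases hV.mem_seg_or hy p with h | h
  · rw [mem_seg] at h
    rwa [show y = p from dist_le_zero.1 (by linarith)]
  rcases hV.mem_seg_or h q with h | h
  · exact hV.seg_subset hp hq h
  · rw [seg_comm, mem_seg] at h
    rwa [show y = q from dist_le_zero.1 (by linarith)]

theorem IsGeodesicOn.mem_seg {γ : ℝ → T} {I : Set ℝ} (hγ : IsGeodesicOn γ I) {s t u : ℝ}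
    (hs : s ∈ I) (ht : t ∈ I) (hu : u ∈ I) (hst : s ≤ t) (htu : t ≤ u) :
    γ t ∈ seg (γ s) (γ u) := by
  rw [GBS.mem_seg, hγ s hs t ht, hγ t ht u hu, hγ s hs u hu, abs_sub_comm,
    abs_of_nonneg (sub_nonneg.2 hst), abs_sub_comm, abs_of_nonneg (sub_nonneg.2 htu),
    abs_sub_comm, abs_of_nonneg (sub_nonneg.2 (hst.trans htu))]
  ring

theorem IsGeodesicOn.exists_eq_of_mem_seg (hV : IsSimplicialTree V) {γ : ℝ → T} {I : Set ℝ}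
    (hγ : IsGeodesicOn γ I) (hI : I.OrdConnected) {b c : ℝ} (hb : b ∈ I) (hc : c ∈ I)
    (hbc : b ≤ c) {y : T} (hy : y ∈ seg (γ b) (γ c)) : ∃ t ∈ Set.Icc b c, γ t = y := by
  have hd : dist (γ b) (γ c) = c - b := by
    rw [hγ b hb c hc, abs_sub_comm, abs_of_nonneg (sub_nonneg.2 hbc)]
  have hle : dist (γ b) y ≤ c - b := by
    rw [GBS.mem_seg] at hy
    linarith [dist_nonneg (x := y) (y := γ c)]
  have ht : b + dist (γ b) y ∈ Set.Icc b c :=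
    ⟨by linarith [dist_nonneg (x := γ b) (y := y)], by linarith⟩
  have htI := hI.out hb hc ht
  refine ⟨_, ht, hV.eq_of_mem_seg (hγ.mem_seg hb htI hc ht.1 ht.2) hy ?_⟩
  rw [hγ b hb _ htI, abs_sub_comm, add_sub_cancel_left, abs_of_nonneg dist_nonneg]

/-- If the images of `x` and `y` agreed, `h e` would be within r(μ - 1) of `h y`, though stretching
puts it at least rμ away. -/
theorem IsBBT.ne_of_far {h : T → T} {μ r : ℝ} (hr : 0 < r) (hB : IsBBT h (r * (μ - 1)))
    (hμ : 0 ≤ μ) {x e y : T} (he : e ∈ seg x y) (hey : r ≤ dist e y)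
    (hd : dist (h e) (h y) = μ * dist e y) : h x ≠ h y := by
  intro hxy
  obtain ⟨p, hp, hep⟩ := hB x y e he
  rw [hxy] at hp
  rw [mem_seg_self hp, hd] at hep
  linarith [mul_le_mul_of_nonneg_left hey hμ]

variable {G : Type u} [Group G] [MulAction G T] {φ : MulAut G} {f : T → T} {lam : ℝ}
  {γ : ℝ → T} {I : Set ℝ}

namespace IsTrainTrack

theorem dist_iterate_subpath (hf : IsTrainTrack V φ f lam) (hV : IsSimplicialTree V)
    (hγ : IsGeodesicOn γ I) (hI : I.OrdConnected) {b c : ℝ} (hb : b ∈ I) (hc : c ∈ I)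
    (hleg : Legal V f (γ b) (γ c)) (n : ℕ) {s t : ℝ} (hs : s ∈ Set.Icc b c)
    (ht : t ∈ Set.Icc b c) :
    dist (f^[n] (γ s)) (f^[n] (γ t)) = lam ^ n * dist (γ s) (γ t) := by
  wlog hst : s ≤ t generalizing s t
  · rw [dist_comm, dist_comm (γ s)]
    exact this ht hs (le_of_not_ge hst)
  have hsI := hI.out hb hc hs
  have htI := hI.out hb hc ht
  refine hf.dist_iterate_of_legal hV (fun w a b' hcr => hleg w a b' ?_) n
  exact (hcr.mono_right (hγ.mem_seg hsI htI hc hst ht.2)).mono_left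
    (hγ.mem_seg hb hsI hc hs.1 hs.2)

variable {B : ℝ} {b c : ℝ}

theorem isBBT_iterate (hf : IsTrainTrack V φ f lam) (hV : IsSimplicialTree V) (hlam : 1 < lam)
    (hB : IsBBT f B) (n : ℕ) :
    IsBBT f^[n] (criticalConstant B lam / 2 * (lam ^ n - 1)) := by
  refine IsBBT.iterate hf.stretch_pos.le (hf.dist_map_le hV) ?_ n
  have : criticalConstant B lam / 2 * (lam - 1) = B := by
    have : lam - 1 ≠ 0 := by linarith
    rw [criticalConstant]
    field_simp
  rwa [this]

theorem disjoint_iterate_trim (hf : IsTrainTrack V φ f lam) (hV : IsSimplicialTree V)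
    (hlam : 1 < lam) (hB : IsBBT f B) (hγ : IsGeodesicOn γ I) (hI : I.OrdConnected)
    (hb : b ∈ I) (hc : c ∈ I) (hbc : b ≤ c) (hleg : Legal V f (γ b) (γ c)) (n : ℕ) :
    Disjoint (f^[n] '' (γ '' I \ trim (γ b) (γ c) (criticalConstant B lam / 2)))
      (f^[n] '' trim (γ b) (γ c) (criticalConstant B lam / 2)) := by
  have hpow : 0 < lam ^ n := pow_pos hf.stretch_pos n
  rw [Set.disjoint_left]
  rintro _ ⟨_, ⟨⟨s, hs, rfl⟩, hsβ⟩, rfl⟩ ⟨y, hyβ, hyx⟩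
  have : Nonempty T := ⟨y⟩
  -- For B = 0 the margin r vanishes, and injectivity takes its place.
  rcases hB.nonneg.eq_or_lt with rfl | hBpos
  · exact hsβ ((hB.injective hV hf.stretch_pos hf.stretch).iterate n hyx ▸ hyβ)
  have hr : 0 < criticalConstant B lam / 2 := by
    rw [criticalConstant]
    exact half_pos (div_pos (by linarith) (by linarith))
  have hBn := hf.isBBT_iterate hV hlam hB n
  obtain ⟨hy, hby, hyc⟩ := hyβ
  obtain ⟨t, ht, rfl⟩ := hγ.exists_eq_of_mem_seg hV hI hb hc hbc hy
  have htI := hI.out hb hc ht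
  have hscale : ∀ {s : ℝ}, s ∈ Set.Icc b c →
      dist (f^[n] (γ s)) (f^[n] (γ t)) = lam ^ n * dist (γ s) (γ t) :=
    fun hs' => hf.dist_iterate_subpath hV hγ hI hb hc hleg n hs' ht
  rcases lt_or_ge s b with hsb | hsb
  · exact IsBBT.ne_of_far hr hBn hpow.le (hγ.mem_seg hs hb htI hsb.le ht.1) hby
      (hscale ⟨le_rfl, hbc⟩) hyx.symm
  rcases lt_or_ge c s with hsc | hsc
  · refine IsBBT.ne_of_far hr hBn hpow.le (e := γ c) ?_ (by rwa [dist_comm])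
      (hscale ⟨hbc, le_rfl⟩) hyx.symm
    rw [seg_comm]
    exact hγ.mem_seg htI hc hs ht.2 hsc.le
  · have h0 := hscale ⟨hsb, hsc⟩
    rw [hyx, dist_self] at h0
    have := dist_eq_zero.1 ((mul_eq_zero.1 h0.symm).resolve_left hpow.ne')
    exact hsβ (this ▸ ⟨hy, hby, hyc⟩)

theorem iterate_trim_subset_tighten (hf : IsTrainTrack V φ f lam) (hV : IsSimplicialTree V)
    (hlam : 1 < lam) (hB : IsBBT f B) (hγ : IsGeodesicOn γ I)
    (hb : b ∈ I) (hc : c ∈ I) (hbc : b ≤ c) (hleg : Legal V f (γ b) (γ c)) (n : ℕ) :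
    f^[n] '' trim (γ b) (γ c) (criticalConstant B lam / 2) ⊆ tighten f^[n] γ I := by
  have hpow : 0 < lam ^ n := pow_pos hf.stretch_pos n
  rintro _ ⟨y, ⟨hy, hby, hyc⟩, rfl⟩
  -- The ends of β serve as cutoffs: any larger subpath of α contains β.
  refine ⟨b, hb, c, hc, fun s hs hsb t ht hct => ?_⟩
  have : Nonempty T := ⟨y⟩
  have hr : 0 ≤ criticalConstant B lam / 2 := by
    rw [criticalConstant]
    exact div_nonneg (div_nonneg (by linarith [hB.nonneg]) (by linarith)) zero_le_two
  have hBn := hf.isBBT_iterate hV hlam hB n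
  obtain ⟨p, hp, hbp⟩ := hBn _ _ _ (hγ.mem_seg hs hb ht hsb (hbc.trans hct))
  obtain ⟨q, hq, hcq⟩ := hBn _ _ _ (hγ.mem_seg hs hc ht (hsb.trans hbc) hct)
  have hle := hV.dist_map_le (hf.dist_iterate_edge hV n)
  have hbc' := hf.dist_iterate_of_legal hV hleg n
  obtain ⟨h1, h2⟩ := IsSimplicialTree.dist_map_eq_of_mem_seg hle hbc' hy
  rw [dist_comm, dist_comm (γ b)] at hbc'
  obtain ⟨h3, -⟩ := IsSimplicialTree.dist_map_eq_of_mem_seg hle hbc' (by rwa [seg_comm])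
  rw [dist_comm] at hyc
  -- The ends of β map to within r(λ^n - 1) of `p` and `q`, while the image of `y` is at least rλ^n
  -- from them, so it lies between `p` and `q` or equals one of them.
  refine hV.mem_seg_of_near h2 hp hq (hbp.trans ?_) (hcq.trans ?_)
  · rw [h1]
    linarith [mul_le_mul_of_nonneg_left hby hpow.le]
  · rw [h3]
    linarith [mul_le_mul_of_nonneg_left hyc hpow.le]

theorem len_trim_le (hf : IsTrainTrack V φ f lam) (hV : IsSimplicialTree V)
    (hlam : 1 < lam) (hB : IsBBT f B) (hγ : IsGeodesicOn γ I) (hI : I.OrdConnected)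
    (hb : b ∈ I) (hc : c ∈ I) (hbc : b ≤ c) (hleg : Legal V f (γ b) (γ c)) (n : ℕ) :
    ENNReal.ofReal (lam ^ n) * len (trim (γ b) (γ c) (criticalConstant B lam / 2)) ≤
      len (tighten f^[n] γ I) := by
  have hsub := hf.iterate_trim_subset_tighten hV hlam hB hγ hb hc hbc hleg n
  -- The factor moves inside the supremum defining the diameter, leaving a comparison for each pair
  -- of points of β'.
  simp only [len, Metric.ediam, ENNReal.mul_iSup]
  refine iSup₂_le fun x hx => iSup₂_le fun y hy => ?_
  refine le_trans (le_of_eq ?_)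
    (Metric.edist_le_ediam_of_mem (hsub ⟨x, hx, rfl⟩) (hsub ⟨y, hy, rfl⟩))
  obtain ⟨s, hs, rfl⟩ := hγ.exists_eq_of_mem_seg hV hI hb hc hbc hx.1
  obtain ⟨t, ht, rfl⟩ := hγ.exists_eq_of_mem_seg hV hI hb hc hbc hy.1
  rw [edist_dist, edist_dist, hf.dist_iterate_subpath hV hγ hI hb hc hleg n hs ht,
    ENNReal.ofReal_mul (pow_pos hf.stretch_pos n).le]

end IsTrainTrack

end LegalSubpaths

end GBS

theorem mainTheorem1 {G : Type*} [Group G] (hG : GBS.IsGBSGroup G)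
    (hsol : ¬ Group.IsSolvable G)
    {T : Type*} [MetricSpace T] [MulAction G T] (V : Set T)
    (hT : GBS.InDeformationSpace G V)
    (φ : MulAut G) (hφ : GBS.FullyIrreducible φ)
    (f : T → T) (lam : ℝ) (hf : GBS.IsTrainTrack V φ f lam) (hlam : 1 < lam) :
    (∃ B : ℝ, GBS.IsBBT f B) ∧
    ∀ B : ℝ, GBS.IsBBT f B →
      ∀ (γ : ℝ → T) (I : Set ℝ), I.OrdConnected → GBS.IsGeodesicOn γ I →
      ∀ b ∈ I, ∀ c ∈ I, b ≤ c → GBS.Legal V f (γ b) (γ c) →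
        2 * GBS.criticalConstant B lam ≤ dist (γ b) (γ c) →
      ∀ β' : Set T, β' = GBS.trim (γ b) (γ c) (GBS.criticalConstant B lam / 2) →
      ∀ n : ℕ,
        Disjoint (f^[n] '' (γ '' I \ β')) (f^[n] '' β') ∧
        f^[n] '' β' ⊆ GBS.tighten f^[n] γ I ∧
        ENNReal.ofReal (lam ^ n) * GBS.len β' ≤ GBS.len (GBS.tighten f^[n] γ I) := by
  have hV := hT.cyclicTree.tree
  refine ⟨hf.exists_isBBT hT.cyclicTree, ?_⟩
  rintro B hB γ I hI hγ b hb c hc hbc hleg - _ rfl n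
  exact ⟨hf.disjoint_iterate_trim hV hlam hB hγ hI hb hc hbc hleg n,
    hf.iterate_trim_subset_tighten hV hlam hB hγ hb hc hbc hleg n,
    hf.len_trim_le hV hlam hB hγ hI hb hc hbc hleg n⟩
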